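/- Let $K$ be a number field with $[K:\mathbb{Q}]=d$, let $S$ be a set of places of $K$, possibly infinite, that contains all archimedean places, and let $\mathcal{O}_S$ be the ring of all elements of $K$ that are integral at every place outside $S$. For an ideal $\mathfrak{q}$ of $\mathcal{O}_S$ let $SL_2(\mathcal{O}_S,\mathfrak{q})$ be the group of all $X\in SL_2(\mathcal{O}_S)$ with $X\equiv I_2 \pmod{\mathfrak{q}}$, and let $NE_2(\mathcal{O}_S,\mathfrak{q})$ be the normal subgroup of $SL_2(\mathcal{O}_S)$ generated by all matrices $\begin{pmatrix}1&r\\0&1\end{pmatrix}$ with $r\in\mathfrak{q}$. A subgroup $H$ of $SL_2(\mathcal{O}_S)$ is called a congruence subgroup if $SL_2(\mathcal{O}_S,\mathfrak{q})\leq H$ for some ideal $\mathfrak{q}\neq\{0\}$; the level $l(H)$ of $H$ is the largest ideal $\mathfrak{q}$ of $\mathcal{O}_S$ with $NE_2(\mathcal{O}_S,\mathfrak{q})\leq H$. Then every congruence subgroup $H$ of $SL_2(\mathcal{O}_S)$ has finite index in $SL_2(\mathcal{O}_S)$, the ring $\mathcal{O}_S/l(H)$ is finite, and $$|\mathcal{O}_S/l(H)|\leq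 |SL_2(\mathcal{O}_S):H|^d.$$ -/

import Mathlib

open scoped NumberField MatrixGroups

namespace CongruenceLevel

section Defs

variable {R : Type*} [CommRing R]

/-- The translation matrix `T(r)` with rows `(1, r)` and `(0, 1)`. -/
def T (r : R) : SL(2, R) := ⟨!![1, r; 0, 1], by simp⟩

/-- `NE₂(R, q)`: the normal subgroup of `SL₂(R)` generated by the translations `T(r)`, `r ∈ q`. -/
def NE2 (q : Ideal R) : Subgroup SL(2, R) :=
  Subgroup.normalClosure (T '' (q : Set R))

/-- `SL₂(R, q)`: the matrices in `SL₂(R)` that are congruent to the identity modulo `q`. -/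
def principal (q : Ideal R) : Subgroup SL(2, R) :=
  (Matrix.SpecialLinearGroup.map (n := Fin 2) (Ideal.Quotient.mk q)).ker

/-- A congruence subgroup contains `SL₂(R, q)` for some nonzero ideal `q`. -/
def IsCongruence (H : Subgroup SL(2, R)) : Prop :=
  ∃ q : Ideal R, q ≠ ⊥ ∧ principal q ≤ H

/-- The level of `H`: the largest ideal `q` with `NE₂(R, q) ≤ H`. It is written as the sum of all
such ideals; `isGreatest_level` shows that this sum is itself such an ideal. -/
def level (H : Subgroup SL(2, R)) : Ideal R :=
  sSup {q : Ideal R | NE2 q ≤ H}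

theorem T_add (a b : R) : T (a + b) = T a * T b := by
  apply Subtype.ext
  rw [Matrix.SpecialLinearGroup.coe_mul]
  simp [T, Matrix.mul_fin_two, add_comm]

theorem T_zero : T (0 : R) = 1 := by
  apply Subtype.ext
  simp [T, Matrix.one_fin_two]

theorem NE2_le_iff (q : Ideal R) (H : Subgroup SL(2, R)) :
    NE2 q ≤ H ↔ ∀ r ∈ q, T r ∈ H.normalCore := by
  constructor
  · intro h r hr
    have h1 : NE2 q ≤ H.normalCore :=
      haveI : (NE2 q).Normal := Subgroup.normalClosure_normal
      Subgroup.normal_le_normalCore.mpr h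
    exact h1 (Subgroup.subset_normalClosure ⟨r, hr, rfl⟩)
  · intro h
    refine le_trans (Subgroup.normalClosure_le_normal ?_) (Subgroup.normalCore_le H)
    rintro _ ⟨r, hr, rfl⟩
    exact h r hr

theorem isGreatest_level (H : Subgroup SL(2, R)) :
    IsGreatest {q : Ideal R | NE2 q ≤ H} (level H) := by
  refine ⟨?_, fun q hq => le_sSup hq⟩
  refine (NE2_le_iff _ H).mpr ?_
  intro r hr
  rw [level, sSup_eq_iSup'] at hr
  refine Submodule.iSup_induction _ (motive := fun r => T r ∈ H.normalCore) hr ?_ ?_ ?_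
  · rintro ⟨q, hq⟩ x hx
    exact (NE2_le_iff q H).mp hq x hx
  · rw [T_zero]
    exact one_mem _
  · intro x y hx hy
    rw [T_add]
    exact mul_mem hx hy

/-- Entrywise description of `SL₂(R, q)`. -/
theorem mem_principal_iff (q : Ideal R) (X : SL(2, R)) :
    X ∈ principal q ↔ ∀ i j, X.1 i j - (1 : Matrix (Fin 2) (Fin 2) R) i j ∈ q := by
  rw [principal, MonoidHom.mem_ker, Matrix.SpecialLinearGroup.ext_iff]
  refine forall_congr' fun i => forall_congr' fun j => ?_
  rw [← Ideal.Quotient.eq_zero_iff_mem, map_sub, sub_eq_zero]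
  by_cases h : i = j <;> simp [Matrix.one_apply, h]

end Defs

/-- The ring of `S`-integers of a number field `K`: the elements of `K` that are integral at every
finite place outside `S`. Archimedean places always belong to the set of places that is inverted,
so that only its set `S` of finite places (the nonzero primes of `𝓞 K`) has to be given. -/
noncomputable abbrev SIntegers (K : Type*) [Field K] [NumberField K]
    (S : Set (IsDedekindDomain.HeightOneSpectrum (𝓞 K))) : Subalgebra (𝓞 K) K :=
  S.integer K

end CongruenceLevel

/-! Write `R` for the ring of `S`-integers. A nonzero ideal of `R` contains a positive integer, so
`H` contains `SL₂(R, M)` for some `M > 0`. Let `n` be the least positive integer such that `nR` lies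
in every cusp amplitude `{r | g T(r) g⁻¹ ∈ H}`; then `nR ≤ level H`. As `R` embeds in `K`, `|R/nR| ≤
n ^ d`, so `n ≤ H.index` is enough.

One amplitude is an additive subgroup of index `k ≤ H.index` and contains `kR` by Lagrange. The crux
is a single `g` whose amplitude already forces `n ∣ k` (`exists_amplitude_exponent`). Strong
approximation glues it from witnesses at the primes dividing `n`, and a commutator argument
(`mem_amplitude_of_mul_inv_mem_principal`) transfers membership between `g` and each witness. -/

namespace CongruenceLevel

/-! ### Counting classes modulo an integer -/

section FiniteRank

variable {V : Type*} [AddCommGroup V] [Module ℚ V] [FiniteDimensional ℚ V]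

/-- A finitely generated subgroup of a rational vector space of dimension `d` has at most `m ^ d`
classes modulo `m`. -/
theorem exists_smul_of_pow_finrank_lt_card (W : Submodule ℤ V) (hW : W.FG) {m : ℕ} (hm : 0 < m)
    (s : Finset W) (hs : m ^ Module.finrank ℚ V < s.card) :
    ∃ x ∈ s, ∃ y ∈ s, x ≠ y ∧ ∃ z : W, x - y = (m : ℤ) • z := by
  have : Module.Finite ℤ W := Module.Finite.iff_fg.mpr hW
  have : IsAddTorsionFree V := IsAddTorsionFree.of_module_rat V
  have : Module.IsTorsionFree ℤ W := inferInstance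
  have : NeZero m := ⟨hm.ne'⟩
  let b := Module.finBasis ℤ W
  have hrank : Module.finrank ℤ W ≤ Module.finrank ℚ V := by
    have hli : LinearIndependent ℤ (fun i => (b i : V)) :=
      b.linearIndependent.map' W.subtype W.ker_subtype
    rw [LinearIndependent.iff_fractionRing ℤ ℚ] at hli
    simpa using hli.fintype_card_le_finrank
  have hcard : (Finset.univ : Finset (Fin (Module.finrank ℤ W) → ZMod m)).card < s.card := by
    rw [Finset.card_univ, Fintype.card_fun, ZMod.card, Fintype.card_fin]
    exact lt_of_le_of_lt (Nat.pow_le_pow_right hm hrank) hs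
  -- Pigeonhole on the coordinates modulo `m` in a `ℤ`-basis of `W`.
  obtain ⟨x, hx, y, hy, hxy, h⟩ := Finset.exists_ne_map_eq_of_card_lt_of_maps_to hcard
    (f := fun x i => ((b.repr x i : ℤ) : ZMod m)) (fun _ _ => Finset.mem_coe.mpr (Finset.mem_univ _))
  refine ⟨x, hx, y, hy, hxy, ?_⟩
  have hdvd (i) : (m : ℤ) ∣ b.repr x i - b.repr y i := by
    have := congrFun h i
    rwa [eq_comm, ZMod.intCast_eq_intCast_iff_dvd_sub] at this
  choose c hc using hdvd
  refine ⟨∑ i, c i • b i, b.repr.injective (Finsupp.ext fun i => ?_)⟩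
  rw [map_smul, Finsupp.smul_apply, b.repr_sum_self, map_sub, Finsupp.sub_apply, hc, smul_eq_mul]

/-- A ring embedding into a rational vector space of dimension `d` has at most `m ^ d` classes
modulo `m`. -/
theorem finite_quotient_natCast {R : Type*} [CommRing R] (f : R →+ V)
    (hf : Function.Injective f) {m : ℕ} (hm : 0 < m) :
    Finite (R ⧸ Ideal.span {(m : R)}) ∧
      Nat.card (R ⧸ Ideal.span {(m : R)}) ≤ m ^ Module.finrank ℚ V := by
  set q := Ideal.span {(m : R)}
  have key (s : Finset (R ⧸ q)) : s.card ≤ m ^ Module.finrank ℚ V := by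
    classical
    by_contra! hs
    let lift : R ⧸ q → R := Function.surjInv Ideal.Quotient.mk_surjective
    have hlift (x) : Ideal.Quotient.mk q (lift x) = x := Function.surjInv_eq _ x
    -- `R` need not be finitely generated over `ℤ`; the span of finitely many representatives is.
    let U : Submodule ℤ R := Submodule.span ℤ (lift '' s)
    let F : R →ₗ[ℤ] V := f.toIntLinearMap
    have hU : U.FG := Submodule.fg_span (s.finite_toSet.image _)
    let g : R ⧸ q → U.map F := fun x => if h : x ∈ s then
      ⟨F (lift x), Submodule.mem_map_of_mem (Submodule.subset_span ⟨x, h, rfl⟩)⟩ else 0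
    have hg {x} (hx : x ∈ s) : (g x : V) = f (lift x) := by simp [g, hx, F]
    have hinj : Set.InjOn g s := fun x hx y hy hxy => by
      have := congrArg (Subtype.val) hxy
      rw [hg hx, hg hy] at this
      rw [← hlift x, ← hlift y, hf this]
    obtain ⟨x', hx', y', hy', hne, ⟨_, u, hu, rfl⟩, hz⟩ :=
      exists_smul_of_pow_finrank_lt_card (U.map F) (hU.map F) hm (s.image g)
        (by rwa [Finset.card_image_of_injOn hinj])
    obtain ⟨x, hx, rfl⟩ := Finset.mem_image.mp hx'
    obtain ⟨y, hy, rfl⟩ := Finset.mem_image.mp hy'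
    refine hne (congrArg g ?_)
    have h1 := congrArg Subtype.val hz
    rw [Submodule.coe_sub, hg hx, hg hy, ← map_sub] at h1
    have h2 : lift x - lift y = m * u := hf (by
      rw [h1, ← nsmul_eq_mul, map_nsmul]
      simp [F])
    rw [← hlift x, ← hlift y, Ideal.Quotient.eq, h2]
    exact Ideal.mul_mem_right _ _ (Ideal.mem_span_singleton_self _)
  have hfin : Finite (R ⧸ q) := by
    by_contra h
    rw [not_finite_iff_infinite] at h
    obtain ⟨s, hs⟩ := Infinite.exists_subset_card_eq (R ⧸ q) (m ^ Module.finrank ℚ V + 1)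
    have := key s
    omega
  have := Fintype.ofFinite (R ⧸ q)
  exact ⟨hfin, by rw [Nat.card_eq_fintype_card]; exact key Finset.univ⟩

end FiniteRank

/-- A nonzero ideal of an intermediate ring of `𝓞 K ⊆ K` contains a positive integer. -/
theorem exists_natCast_mem {K : Type*} [Field K] [NumberField K] (A : Subalgebra (𝓞 K) K)
    (q : Ideal A) (hq : q ≠ ⊥) : ∃ m : ℕ, 0 < m ∧ (m : A) ∈ q := by
  obtain ⟨x, hx, hx0⟩ := Submodule.exists_mem_ne_zero_of_ne_bot hq
  obtain ⟨a, b, hb, hab⟩ := IsFractionRing.div_surjective (A := 𝓞 K) (x : K)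
  have hb0 : algebraMap (𝓞 K) K b ≠ 0 := by simpa using nonZeroDivisors.ne_zero hb
  have ha0 : a ≠ 0 := by
    rintro rfl
    rw [map_zero, zero_div] at hab
    exact hx0 (Subtype.ext hab.symm)
  obtain ⟨c, hc⟩ := Ideal.mem_span_singleton.mp (Ideal.absNorm_mem (Ideal.span {a}))
  -- With `x = a / b` and norm `a * c`, the norm equals `b * c * x`.
  refine ⟨Ideal.absNorm (Ideal.span {a}), Nat.pos_of_ne_zero ?_, ?_⟩
  · simpa [Ideal.absNorm_eq_zero_iff] using ha0
  · have : ((Ideal.absNorm (Ideal.span {a}) : ℕ) : A) = algebraMap (𝓞 K) A (b * c) * x := by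
      apply Subtype.ext
      have h1 : algebraMap (𝓞 K) K (Ideal.absNorm (Ideal.span {a}) : ℕ) =
          algebraMap (𝓞 K) K (a * c) := congrArg _ hc
      rw [map_natCast, map_mul] at h1
      have h2 : ((algebraMap (𝓞 K) A (b * c) : A) : K) = algebraMap (𝓞 K) K (b * c) := rfl
      rw [Subalgebra.coe_mul, h2, ← hab, map_mul]
      push_cast
      rw [h1]
      field_simp
    rw [this]
    exact Ideal.mul_mem_left _ _ hx

/-- Finite rings have stable rank one. -/
theorem exists_isUnit_add_mul {A : Type*} [CommRing A] [Finite A] {w z : A}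
    (h : IsCoprime w z) : ∃ t, IsUnit (w + z * t) := by
  obtain ⟨i, j, hij, hw⟩ : ∃ i j : ℕ, i < j ∧ w ^ i = w ^ j := by
    obtain ⟨i, j, hne, hw⟩ := Finite.exists_ne_map_eq_of_infinite (fun n : ℕ => w ^ n)
    rcases lt_or_gt_of_ne hne with hlt | hlt
    exacts [⟨i, j, hlt, hw⟩, ⟨j, i, hlt, hw.symm⟩]
  -- Modulo a maximal ideal containing `w` this is `1`, and `w + z * t` becomes `z`; modulo any
  -- other it is `0`, and `w` remains.
  refine ⟨1 - w ^ (j - i), ?_⟩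
  by_contra hu
  obtain ⟨I, hI, hmem⟩ := exists_max_ideal_of_mem_nonunits hu
  have hprod : w ^ i * (1 - w ^ (j - i)) ∈ I := by
    rw [mul_sub, mul_one, ← pow_add, Nat.add_sub_cancel' hij.le, hw, sub_self]
    exact I.zero_mem
  obtain ⟨u, v, huv⟩ := h
  have hnot {s : A} (hs : s ∈ I) (hs1 : 1 - s ∈ I) : False :=
    hI.ne_top ((Ideal.eq_top_iff_one I).mpr (by simpa using I.add_mem hs hs1))
  by_cases hwI : w ∈ I
  · have hz : z * (1 - w ^ (j - i)) ∈ I := by simpa using I.sub_mem hmem hwI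
    have hwp : w ^ (j - i) ∈ I := I.pow_mem_of_mem hwI _ (by omega)
    rcases hI.isPrime.mem_or_mem hz with hz | hz
    · exact hI.ne_top ((Ideal.eq_top_iff_one I).mpr
        (huv ▸ I.add_mem (I.mul_mem_left u hwI) (I.mul_mem_left v hz)))
    · exact hnot hwp hz
  · rcases hI.isPrime.mem_or_mem hprod with hz | hz
    · exact hwI (hI.isPrime.mem_of_pow_mem _ hz)
    · exact hwI (by simpa using I.sub_mem hmem (I.mul_mem_left z hz))

/-! ### Strong approximation for two ideals -/

section Subgroups

variable {R : Type*} [CommRing R]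

instance principal_normal (q : Ideal R) : (principal q).Normal := by
  rw [principal]
  infer_instance

theorem principal_mono {p q : Ideal R} (h : p ≤ q) : principal p ≤ principal q := fun X hX => by
  rw [mem_principal_iff] at hX ⊢
  exact fun i j => h (hX i j)

theorem T_mem_principal {q : Ideal R} {r : R} (hr : r ∈ q) : T r ∈ principal q := by
  rw [mem_principal_iff]
  intro i j
  fin_cases i <;> fin_cases j <;> simp [T, hr]

/-- A normal subgroup that contains all translations and a principal congruence subgroup of a
nonzero ideal with finite quotient is everything. -/
theorem eq_top_of_T_mem_of_principal_le (N : Subgroup SL(2, R)) [N.Normal] (q : Ideal R)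
    [Finite (R ⧸ q)] (hT : ∀ r, T r ∈ N) (hq : principal q ≤ N) : N = ⊤ := by
  let w : SL(2, R) := ⟨!![0, 1; -1, 0], by simp⟩
  let L (r : R) : SL(2, R) := ⟨!![1, 0; r, 1], by simp⟩
  have cT (r : R) : (T r).1 = !![1, r; 0, 1] := rfl
  have cL (r : R) : (L r).1 = !![1, 0; r, 1] := rfl
  have cw : w.1 = !![0, 1; -1, 0] := rfl
  have cmul (A B : SL(2, R)) : (A * B).1 = A.1 * B.1 := rfl
  have hL (r) : L r ∈ N := by
    have h : w * L r = T (-r) * w := Subtype.ext (by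
      rw [cmul, cmul, cT, cL, cw]
      simp)
    have h' : L r = w⁻¹ * T (-r) * w⁻¹⁻¹ := by rw [inv_inv, mul_assoc, ← h, inv_mul_cancel_left]
    rw [h']
    exact Subgroup.Normal.conj_mem ‹_› _ (hT _) _
  have hw : w ∈ N := by
    have h : w = T 1 * L (-1) * T 1 := Subtype.ext (by
      rw [cmul, cmul, cT, cL, cw]
      simp)
    rw [h]
    exact N.mul_mem (N.mul_mem (hT _) (hL _)) (hT _)
  rw [eq_top_iff]
  intro X _
  set π := Ideal.Quotient.mk q
  have hdet : X.1 0 0 * X.1 1 1 - X.1 0 1 * X.1 1 0 = 1 := by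
    rw [← Matrix.det_fin_two]; exact X.2
  have hdet' : π (X.1 0 0) * π (X.1 1 1) - π (X.1 0 1) * π (X.1 1 0) = 1 := by
    rw [← map_mul, ← map_mul, ← map_sub, hdet, map_one]
  -- Stable rank one makes the lower right entry a unit modulo `q`; its inverse `v` then lets a
  -- column operation turn the lower left entry into `1`.
  obtain ⟨t', ht'⟩ := exists_isUnit_add_mul (w := π (X.1 1 1)) (z := π (X.1 1 0))
    ⟨π (X.1 0 0), -π (X.1 0 1), by linear_combination hdet'⟩
  obtain ⟨v', hv'⟩ := ht'.exists_right_inv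
  obtain ⟨t, rfl⟩ := Ideal.Quotient.mk_surjective t'
  obtain ⟨v, rfl⟩ := Ideal.Quotient.mk_surjective v'
  change (π _ + π _ * π t) * π v = 1 at hv'
  -- The bottom row of `Y` is `(1, 0)` modulo `q`.
  let Y := X * T t * L (v * (1 - X.1 1 0)) * T (-(X.1 1 1 + X.1 1 0 * t))
  -- Clearing the upper left entry of `Y` leaves `w⁻¹` modulo `q`.
  have hY : w * (T (-Y.1 0 0) * Y) ∈ N := by
    apply hq
    have h10 : π (Y.1 1 0) = 1 := by
      simp [Y, cmul, cT, cL, Matrix.mul_apply, Fin.sum_univ_two]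
      linear_combination (1 - π (X.1 1 0)) * hv'
    have h11 : π (Y.1 1 1) = 0 := by
      have : Y.1 1 1 = Y.1 1 0 * (-(X.1 1 1 + X.1 1 0 * t)) + (X.1 1 1 + X.1 1 0 * t) := by
        simp [Y, cmul, cT, cL, Matrix.mul_apply, Fin.sum_univ_two]
        ring
      rw [this, map_add, map_mul, h10, map_neg]
      ring
    have h01 : π (Y.1 0 1) = -1 := by
      have h := congrArg π ((Matrix.det_fin_two Y.1).symm.trans Y.2)
      rw [map_sub, map_mul, map_mul, h10, h11, map_one] at h
      linear_combination -h
    rw [mem_principal_iff]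
    have e00 : (w * (T (-Y.1 0 0) * Y)).1 0 0 = Y.1 1 0 := by
      simp [cmul, cT, cw, Matrix.vecMul, dotProduct]
    have e01 : (w * (T (-Y.1 0 0) * Y)).1 0 1 = Y.1 1 1 := by
      simp [cmul, cT, cw, Matrix.vecMul, dotProduct]
    have e10 : (w * (T (-Y.1 0 0) * Y)).1 1 0 = -Y.1 0 0 + Y.1 0 0 * Y.1 1 0 := by
      simp [cmul, cT, cw, Matrix.vecMul, dotProduct]
      ring
    have e11 : (w * (T (-Y.1 0 0) * Y)).1 1 1 = -Y.1 0 1 + Y.1 0 0 * Y.1 1 1 := by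
      simp [cmul, cT, cw, Matrix.vecMul, dotProduct]
      ring
    have hπ {x : R} (hx : π x = 0) : x ∈ q := Ideal.Quotient.eq_zero_iff_mem.mp hx
    intro i j
    fin_cases i <;> fin_cases j <;> apply hπ
    · change π ((w * (T (-Y.1 0 0) * Y)).1 0 0 - 1) = 0
      rw [e00, map_sub, h10, map_one, sub_self]
    · change π ((w * (T (-Y.1 0 0) * Y)).1 0 1 - 0) = 0
      rw [e01, sub_zero, h11]
    · change π ((w * (T (-Y.1 0 0) * Y)).1 1 0 - 0) = 0
      rw [e10, sub_zero, map_add, map_mul, h10, map_neg]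
      ring
    · change π ((w * (T (-Y.1 0 0) * Y)).1 1 1 - 1) = 0
      rw [e11, map_sub, map_add, map_mul, h11, map_neg, h01, map_one]
      ring
  have hYN : Y ∈ N := (N.mul_mem_cancel_left (hT _)).mp
    ((N.mul_mem_cancel_left hw).mp hY)
  exact (N.mul_mem_cancel_right (hT _)).mp ((N.mul_mem_cancel_right (hL _)).mp
    ((N.mul_mem_cancel_right (hT _)).mp hYN))

/-- Strong approximation for two coprime ideals. -/
theorem principal_sup_principal {p q : Ideal R} (h : p ⊔ q = ⊤) [Finite (R ⧸ p)] :
    principal p ⊔ principal q = ⊤ := by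
  refine eq_top_of_T_mem_of_principal_le _ p (fun r => ?_) le_sup_left
  obtain ⟨x, hx, y, hy, rfl⟩ := Submodule.mem_sup.mp (h ▸ Submodule.mem_top : r ∈ p ⊔ q)
  rw [T_add]
  exact mul_mem (Subgroup.mem_sup_left (T_mem_principal hx))
    (Subgroup.mem_sup_right (T_mem_principal hy))

/-- Strong approximation for two coprime ideals. -/
theorem exists_mul_inv_mem_principal {p q : Ideal R} (h : p ⊔ q = ⊤) [Finite (R ⧸ p)]
    (X Y : SL(2, R)) : ∃ Z, Z * X⁻¹ ∈ principal p ∧ Z * Y⁻¹ ∈ principal q := by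
  have hmem : Y * X⁻¹ ∈ principal q ⊔ principal p := by
    rw [sup_comm, principal_sup_principal h]
    exact Subgroup.mem_top _
  obtain ⟨b, hb, a, ha, hab⟩ := Subgroup.mem_sup_of_normal_right.mp hmem
  refine ⟨a * X, by simpa using ha, ?_⟩
  have : a * X * Y⁻¹ = b⁻¹ := by
    rw [eq_inv_mul_of_mul_eq hab]
    group
  rw [this]
  exact inv_mem hb

end Subgroups

/-! ### Simultaneous approximation, cusp amplitudes and the index bound -/

section Bound

variable {R : Type*} [CommRing R]

theorem principal_inf (p q : Ideal R) : principal p ⊓ principal q ≤ principal (p ⊓ q) := by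
  rintro X ⟨hp, hq⟩
  replace hp := (mem_principal_iff p X).mp hp
  replace hq := (mem_principal_iff q X).mp hq
  rw [mem_principal_iff]
  exact fun i j => ⟨hp i j, hq i j⟩

/-- Strong approximation for finitely many pairwise coprime ideals. -/
theorem exists_forall_mul_inv_mem_principal {ι : Type*} (s : Finset ι) (I : ι → Ideal R)
    (hI : ∀ i ∈ s, ∀ j ∈ s, i ≠ j → I i ⊔ I j = ⊤) (hfin : ∀ i ∈ s, Finite (R ⧸ I i))
    (f : ι → SL(2, R)) : ∃ Z, ∀ i ∈ s, Z * (f i)⁻¹ ∈ principal (I i) := by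
  classical
  induction s using Finset.induction_on with
  | empty => exact ⟨1, by simp⟩
  | insert i s his ih =>
    obtain ⟨Y, hY⟩ := ih
      (fun j hj k hk => hI j (Finset.mem_insert_of_mem hj) k (Finset.mem_insert_of_mem hk))
      (fun j hj => hfin j (Finset.mem_insert_of_mem hj))
    have := hfin i (Finset.mem_insert_self i s)
    have hcop : I i ⊔ ⨅ j ∈ s, I j = ⊤ := Ideal.sup_iInf_eq_top fun j hj =>
      hI i (Finset.mem_insert_self i s) j (Finset.mem_insert_of_mem hj) (by rintro rfl; exact his hj)
    obtain ⟨Z, hZi, hZ⟩ := exists_mul_inv_mem_principal hcop (f i) Y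
    refine ⟨Z, fun j hj => ?_⟩
    rcases Finset.mem_insert.mp hj with rfl | hj
    · exact hZi
    · have h := mul_mem (principal_mono (iInf₂_le j hj) hZ) (hY j hj)
      rwa [mul_assoc, inv_mul_cancel_left] at h

theorem span_natCast_sup_span_natCast {a b : ℕ} (h : a.Coprime b) :
    Ideal.span {(a : R)} ⊔ Ideal.span {(b : R)} = ⊤ := by
  rw [← Ideal.isCoprime_iff_sup_eq, Ideal.isCoprime_span_singleton_iff]
  exact h.cast

/-- The conjugated translation homomorphism `r ↦ g T(r) g⁻¹`. -/
def conjT (g : SL(2, R)) : Multiplicative R →* SL(2, R) :=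
  MonoidHom.mk' (fun r => g * T r.toAdd * g⁻¹) fun a b => by
    rw [toAdd_mul, T_add]
    group

/-- The cusp amplitude of `H` at `g`: all `r` with `g T(r) g⁻¹ ∈ H`. -/
def amplitude (H : Subgroup SL(2, R)) (g : SL(2, R)) : AddSubgroup R :=
  Subgroup.toAddSubgroup' (H.comap (conjT g))

theorem mem_amplitude {H : Subgroup SL(2, R)} {g : SL(2, R)} {r : R} :
    r ∈ amplitude H g ↔ g * T r * g⁻¹ ∈ H := Iff.rfl

theorem span_natCast_le_level_iff (H : Subgroup SL(2, R)) (n : ℕ) :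
    Ideal.span {(n : R)} ≤ level H ↔ ∀ g r, (n : R) * r ∈ amplitude H g := by
  have hle (q : Ideal R) : q ≤ level H ↔ NE2 q ≤ H :=
    ⟨fun h => (NE2_le_iff q H).mpr fun r hr => (NE2_le_iff _ H).mp (isGreatest_level H).1 r (h hr),
      fun h => (isGreatest_level H).2 h⟩
  rw [hle, NE2_le_iff]
  constructor
  · intro h g r
    exact h _ (Ideal.mul_mem_right _ _ (Ideal.mem_span_singleton_self _)) g
  · rintro h r hr g
    obtain ⟨s, rfl⟩ := Ideal.mem_span_singleton.mp hr
    exact h g s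

/-- The amplitude is the preimage of `H` under a homomorphism from `R`, so its index is at most that
of `H` and annihilates the quotient. -/
theorem exists_index_mul_mem_amplitude (H : Subgroup SL(2, R)) [H.FiniteIndex] (g : SL(2, R)) :
    ∃ k : ℕ, 0 < k ∧ k ≤ H.index ∧ ∀ r, (k : R) * r ∈ amplitude H g := by
  have hne : H.relIndex (⊤ : Subgroup SL(2, R)) ≠ 0 := by
    rw [Subgroup.relIndex_top_right]
    exact Subgroup.FiniteIndex.index_ne_zero
  refine ⟨(H.comap (conjT g)).index, Nat.pos_of_ne_zero ?_, ?_, fun r => ?_⟩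
  · rw [Subgroup.index_comap]
    exact mt (Subgroup.relIndex_eq_zero_of_le_right le_top) hne
  · rw [Subgroup.index_comap, ← Subgroup.relIndex_top_right H]
    exact Subgroup.relIndex_le_of_le_right le_top hne
  · have h := Subgroup.pow_index_mem (H.comap (conjT g)) (Multiplicative.ofAdd r)
    rw [← ofAdd_nsmul, nsmul_eq_mul] at h
    exact h

/-- If `H` contains `SL₂(R, p ⊓ q)`, then the part of its amplitude at `g` that lies in `q` only
depends on `g` modulo `p`. -/
theorem mem_amplitude_of_mul_inv_mem_principal {H : Subgroup SL(2, R)} {p q : Ideal R}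
    (hH : principal (p ⊓ q) ≤ H) {g h : SL(2, R)} (hgh : g * h⁻¹ ∈ principal p) {r : R}
    (hr : r ∈ q) (hrg : r ∈ amplitude H g) : r ∈ amplitude H h := by
  rw [mem_amplitude] at hrg ⊢
  set y := h * T r * h⁻¹ with hy
  have hyq : y ∈ principal q := (principal_normal q).conj_mem _ (T_mem_principal hr) h
  -- A commutator of elements of two normal subgroups lies in both.
  have hcomm : (g * h⁻¹) * y * (g * h⁻¹)⁻¹ * y⁻¹ ∈ H := by
    refine hH (principal_inf p q (Subgroup.mem_inf.mpr ⟨?_, ?_⟩))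
    · have := mul_mem hgh ((principal_normal p).conj_mem _ (inv_mem hgh) y)
      simpa only [mul_assoc] using this
    · exact mul_mem ((principal_normal q).conj_mem _ hyq _) (inv_mem hyq)
  have he : (g * h⁻¹) * y * (g * h⁻¹)⁻¹ * y⁻¹ = (g * T r * g⁻¹) * y⁻¹ := by
    rw [hy]
    group
  rw [he] at hcomm
  exact inv_mem_iff.mp ((H.mul_mem_cancel_left hrg).mp hcomm)

theorem gcd_mul_mem_amplitude {H : Subgroup SL(2, R)} {g : SL(2, R)} {m n : ℕ}
    (hm : ∀ r, (m : R) * r ∈ amplitude H g) (hn : ∀ r, (n : R) * r ∈ amplitude H g) (r : R) :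
    ((m.gcd n : ℕ) : R) * r ∈ amplitude H g := by
  have h : ((m.gcd n : ℕ) : R) = m * (m.gcdA n : ℤ) + n * (m.gcdB n : ℤ) := by
    exact_mod_cast congrArg (Int.cast : ℤ → R) (Nat.gcd_eq_gcd_ab m n)
  rw [h, add_mul, mul_assoc, mul_assoc]
  exact add_mem (hm _) (hn _)

/-- Some cusp amplitude of a congruence subgroup has the same exponent as the intersection of all
cusp amplitudes. -/
theorem exists_amplitude_exponent {H : Subgroup SL(2, R)} {M n : ℕ} (hM : 0 < M)
    (hH : principal (Ideal.span {(M : R)}) ≤ H)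
    (hfin : ∀ k : ℕ, 0 < k → Finite (R ⧸ Ideal.span {(k : R)})) (hn : 0 < n)
    (hnH : ∀ g r, (n : R) * r ∈ amplitude H g)
    (hmin : ∀ k : ℕ, 0 < k → k < n → ∃ g r, (k : R) * r ∉ amplitude H g) :
    ∃ g, ∀ k : ℕ, (∀ r, (k : R) * r ∈ amplitude H g) → n ∣ k := by
  have hMH (g : SL(2, R)) (r : R) : (M : R) * r ∈ amplitude H g :=
    hH ((principal_normal _).conj_mem _
      (T_mem_principal (Ideal.mul_mem_right _ _ (Ideal.mem_span_singleton_self _))) g)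
  -- Minimality of `n` gives a witness against `n / p` for each prime `p ∣ n`; other `p` get dummy
  -- values.
  have hex (p : ℕ) : ∃ g r, p ∈ n.primeFactors → ((n / p : ℕ) : R) * r ∉ amplitude H g := by
    by_cases hp : p ∈ n.primeFactors
    · have hpp := Nat.prime_of_mem_primeFactors hp
      obtain ⟨g, r, h⟩ := hmin (n / p)
        (Nat.div_pos (Nat.le_of_dvd hn (Nat.dvd_of_mem_primeFactors hp)) hpp.pos)
        (Nat.div_lt_self hn hpp.one_lt)
      exact ⟨g, r, fun _ => h⟩
    · exact ⟨1, 0, fun h => absurd h hp⟩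
  choose f r hf using hex
  obtain ⟨g, hg⟩ := exists_forall_mul_inv_mem_principal n.primeFactors
    (fun p => Ideal.span {((p ^ M.factorization p : ℕ) : R)})
    (fun p hp q hq hpq => span_natCast_sup_span_natCast (Nat.Coprime.pow _ _
      ((Nat.coprime_primes (Nat.prime_of_mem_primeFactors hp)
        (Nat.prime_of_mem_primeFactors hq)).mpr hpq)))
    (fun p hp => hfin _ (pow_pos (Nat.prime_of_mem_primeFactors hp).pos _)) f
  refine ⟨g, fun k hk => ?_⟩
  by_contra hnk
  obtain ⟨e, he⟩ := n.gcd_dvd_left k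
  have he1 : e ≠ 1 := by
    rintro rfl
    rw [mul_one] at he
    exact hnk (he ▸ n.gcd_dvd_right k)
  obtain ⟨p, hp, hpe⟩ := Nat.exists_prime_and_dvd he1
  obtain ⟨e', rfl⟩ := hpe
  have hpn : p ∣ n := he ▸ Dvd.intro_left (n.gcd k * e') (by ring)
  have hmem : p ∈ n.primeFactors := Nat.mem_primeFactors.mpr ⟨hp, hpn, hn.ne'⟩
  have hdiv : n / p = n.gcd k * e' := by
    apply Nat.div_eq_of_eq_mul_left hp.pos
    nth_rewrite 1 [he]
    ring
  have hnp (s : R) : ((n / p : ℕ) : R) * s ∈ amplitude H g := by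
    rw [hdiv, Nat.cast_mul, mul_assoc]
    exact gcd_mul_mem_amplitude (hnH g) hk _
  -- In fact `n ∣ M`, since otherwise `n.gcd M` would be a smaller common exponent.
  have hpM : p ∣ M := by
    refine hpn.trans ?_
    by_contra hnM
    have hlt : n.gcd M < n := (Nat.gcd_le_left M hn).lt_of_ne fun h =>
      hnM (h ▸ n.gcd_dvd_right M)
    obtain ⟨h, s, hs⟩ := hmin _ (Nat.gcd_pos_of_pos_left M hn) hlt
    exact hs (gcd_mul_mem_amplitude (hnH h) (hMH h) s)
  set P := p ^ M.factorization p with hP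
  set Q := M / P with hQ
  have hPQ : P.Coprime Q := Nat.coprime_ordCompl hp hM.ne' |>.pow_left _
  have hPQM : P * Q = M := Nat.ordProj_mul_ordCompl_eq_self M p
  have hpP : p ∣ P := dvd_pow_self p (hp.factorization_pos_of_dvd hM.ne' hpM).ne'
  have hinf : Ideal.span {(P : R)} ⊓ Ideal.span {(Q : R)} = Ideal.span {(M : R)} := by
    rw [← hPQM, Nat.cast_mul, ← Ideal.span_singleton_mul_span_singleton,
      Ideal.mul_eq_inf_of_isCoprime]
    exact Ideal.isCoprime_iff_sup_eq.mpr (span_natCast_sup_span_natCast hPQ)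
  obtain ⟨u, v, huv⟩ := (Nat.isCoprime_iff_coprime.mpr hPQ : IsCoprime (P : ℤ) Q)
  have huv' : (u : R) * P + v * Q = 1 := by exact_mod_cast congrArg (Int.cast : ℤ → R) huv
  obtain ⟨P', hP'⟩ := hpP
  have hnP : ((n / p : ℕ) : R) * P = n * P' := by
    rw [hP', ← Nat.cast_mul, ← mul_assoc, Nat.div_mul_cancel hpn, Nat.cast_mul]
  refine hf p hmem ?_
  -- Since `p ∣ P`, the `P`-part lies in `nR`, hence in every amplitude; the `Q`-part transfers from
  -- `g` to `f p`, because these agree modulo `P`.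
  have hsplit : ((n / p : ℕ) : R) * r p =
      n * (P' * u * r p) + ((n / p : ℕ) : R) * (v * Q * r p) := by
    linear_combination (-((n / p : ℕ) : R) * r p) * huv' + (u * r p) * hnP
  rw [hsplit]
  refine add_mem (hnH _ _) (mem_amplitude_of_mul_inv_mem_principal (hinf ▸ hH) (hg p hmem) ?_
    (hnp _))
  exact Ideal.mem_span_singleton.mpr ⟨((n / p : ℕ) : R) * (v * r p), by ring⟩

theorem exists_le_index_and_span_le_level {H : Subgroup SL(2, R)} [H.FiniteIndex] {M : ℕ}
    (hM : 0 < M) (hH : principal (Ideal.span {(M : R)}) ≤ H)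
    (hfin : ∀ k : ℕ, 0 < k → Finite (R ⧸ Ideal.span {(k : R)})) :
    ∃ n : ℕ, 0 < n ∧ n ≤ H.index ∧ Ideal.span {(n : R)} ≤ level H := by
  classical
  have hex : ∃ n : ℕ, 0 < n ∧ ∀ g r, (n : R) * r ∈ amplitude H g :=
    ⟨M, hM, fun g r => hH ((principal_normal _).conj_mem _
      (T_mem_principal (Ideal.mul_mem_right _ _ (Ideal.mem_span_singleton_self _))) g)⟩
  obtain ⟨hn, hnH⟩ := Nat.find_spec hex
  obtain ⟨g, hg⟩ := exists_amplitude_exponent hM hH hfin hn hnH fun k hk hlt => by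
    have h := Nat.find_min hex hlt
    push Not at h
    exact h hk
  obtain ⟨k, hk, hkH, hkg⟩ := exists_index_mul_mem_amplitude H g
  exact ⟨Nat.find hex, hn, (Nat.le_of_dvd hk (hg k hkg)).trans hkH,
    (span_natCast_le_level_iff H _).mpr hnH⟩

end Bound

end CongruenceLevel

open CongruenceLevel in
theorem theorem5p2 (K : Type*) [Field K] [NumberField K]
    (S : Set (IsDedekindDomain.HeightOneSpectrum (𝓞 K)))
    (H : Subgroup SL(2, CongruenceLevel.SIntegers K S))
    (hH : CongruenceLevel.IsCongruence H) :
    H.FiniteIndex ∧ Finite (CongruenceLevel.SIntegers K S ⧸ CongruenceLevel.level H) ∧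
      Nat.card (CongruenceLevel.SIntegers K S ⧸ CongruenceLevel.level H) ≤
        H.index ^ Module.finrank ℚ K := by
  obtain ⟨q, hq, hqH⟩ := hH
  obtain ⟨M, hM, hMq⟩ := exists_natCast_mem (SIntegers K S) q hq
  have hquot (k : ℕ) (hk : 0 < k) :=
    finite_quotient_natCast (SIntegers K S).val.toRingHom.toAddMonoidHom
      Subtype.val_injective hk
  have hMH : principal (Ideal.span {(M : SIntegers K S)}) ≤ H :=
    (principal_mono ((Ideal.span_singleton_le_iff_mem q).mpr hMq)).trans hqH
  have hfi : H.FiniteIndex := by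
    have := (hquot M hM).1
    have : (principal (Ideal.span {(M : SIntegers K S)})).FiniteIndex :=
      Subgroup.finiteIndex_ker _
    exact Subgroup.finiteIndex_of_le hMH
  obtain ⟨n, hn, hnH, hnl⟩ :=
    exists_le_index_and_span_le_level hM hMH fun k hk => (hquot k hk).1
  obtain ⟨hfin, hcard⟩ := hquot n hn
  have hsurj := Ideal.Quotient.factor_surjective hnl
  exact ⟨hfi, Finite.of_surjective _ hsurj,
    (Nat.card_le_card_of_surjective _ hsurj).trans (hcard.trans (Nat.pow_le_pow_left hnH _))⟩
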